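/- Let $n\ge 1$, $\mu_1,\dots,\mu_n>0$, $0<p_i<1$ for $i<n$ and $p_n=0$. Let $B\in\mathbb N\cup\{\infty\}$ be the buffer size. The state space $\Omega$ is the set of families $h=(h_{\ell,i})_{\ell\ge 1,\,1\le i\le n}$ of reals such that, with $h_{\ell,n+1}=0$, $$0\le h_{\ell,i}\le 1,\quad h_{\ell,i+1}\le h_{\ell,i},\quad h_{\ell+1,i}\le h_{\ell,i},\quad h_{\ell,i}+h_{\ell+1,i+1}\ge h_{\ell+1,i}+h_{\ell,i+1},\quad \sum_{\ell} h_{\ell,1}<\infty ,$$ and $h_{\ell,i}=0$ for $\ell>B$. Let $f_{\ell,i}:\Omega\to\mathbb R$ ($\ell\ge1$, $1\le i\le n$) be functions with $f_{1,i}=0$ for $i\ge 2$ and $f_{\ell,i}=0$ for $\ell>B$, and consider the ODEs in $\Omega$ $$\frac{d}{dt}h_{\ell,1}=f_{\ell,1}(h)-\sum_{j=1}^n\big[(h_{\ell,j}-h_{\ell,j+1})-(h_{\ell+1,j}-h_{\ell+1,j+1})\big]\mu_j(1-p_j),$$ $$\frac{d}{dt}h_{\ell,i}=1[\ell>1]f_{\ell,i}(h)+(h_{\ell,i-1}-h_{\ell,i})p_{i-1}\mu_{i-1}-\sum_{j=i}^n(h_{\ell,j}-h_{\ell,j+1})\mu_j(1-p_j)\quad(2\le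 i\le n).$$ Assume that the right-hand side (the drift) is locally Lipschitz on $\Omega$ in the supremum norm $\sup_{\ell,i}|h_{\ell,i}|$. For integers $\ell_1\ge\dots\ge\ell_n\ge1$ with $\ell_1>\ell_n$ put $$g_{(\ell_1,\dots,\ell_n)}(h)=h_{\ell_1,1}+\sum_{i=2}^n(h_{\ell_i,i}-h_{\ell_{i-1},i}),\qquad f_{(\ell_1,\dots,\ell_n)}(h)=f_{\ell_1,1}(h)+\sum_{i=2}^n(f_{\ell_i,i}(h)-f_{\ell_{i-1},i}(h)).$$ For $h,\tilde h\in\Omega$ write $h\le_C\tilde h$ if $h_{\ell,i}\le\tilde h_{\ell,i}$ for all $\ell,i$ and $g_{(\ell_1,\dots,\ell_n)}(h)\le g_{(\ell_1,\dots,\ell_n)}(\tilde h)$ for all such $(\ell_1,\dots,\ell_n)$. Assume: 1. for every $h_0\in\Omega$ the ODEs have a unique solution $h:[0,\infty)\to\Omega$ with $h(0)=h_0$, and they have a fixed point in $\Omega$; 2. each $f_{\ell,i}$ is non-decreasing in the coordinates $h_{\ell',i'}$, $(\ell',i')\ne(\ell,i)$: if $h,\tilde h\in\Omega$, $h\le\tilde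 h$ componentwise and $h_{\ell,i}=\tilde h_{\ell,i}$, then $f_{\ell,i}(h)\le f_{\ell,i}(\tilde h)$; 3. $f_{(\ell_1,\dots,\ell_n)}(h)\le f_{(\ell_1,\dots,\ell_n)}(\tilde h)$ whenever $h\le_C\tilde h$ and $g_{(\ell_1,\dots,\ell_n)}(h)=g_{(\ell_1,\dots,\ell_n)}(\tilde h)$. Assume further that $\mu_i(1-p_i)$ is decreasing (i.e. non-increasing) in $i$. If $h(t)$ and $\tilde h(t)$ are the solutions with $h(0)=h$, $\tilde h(0)=\tilde h$ and $h\le_C\tilde h$, then $h(t)\le_C\tilde h(t)$ for all $t>0$. -/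

import Mathlib

/-!  Mean field ODEs with Coxian service times.

States are families `h ℓ i` with queue length `ℓ ≥ 1` and service phase `1 ≤ i ≤ n`, where `h ℓ i`
is the fraction of queues of length at least `ℓ` whose service phase is at least `i`. They are
stored as functions `ℕ → ℕ → ℝ` that vanish outside this index range (so `h ℓ (n + 1) = 0`).
The buffer size `B : ℕ∞` is `⊤` for infinite buffers. -/

namespace CoxMF

/-- The state space: `Ω` for `B = ⊤`, and `Ω_B` (with `h ℓ i = 0` for `ℓ > B`) for finite `B`. -/
def Omega (n : ℕ) (B : ℕ∞) : Set (ℕ → ℕ → ℝ) :=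
  {h | (∀ ℓ i : ℕ, (ℓ = 0 ∨ i = 0 ∨ n < i ∨ B < (ℓ : ℕ∞)) → h ℓ i = 0) ∧
    (∀ ℓ i : ℕ, 1 ≤ ℓ → 1 ≤ i → i ≤ n →
      0 ≤ h ℓ i ∧ h ℓ i ≤ 1 ∧ h ℓ (i + 1) ≤ h ℓ i ∧ h (ℓ + 1) i ≤ h ℓ i ∧
      h (ℓ + 1) i + h ℓ (i + 1) ≤ h ℓ i + h (ℓ + 1) (i + 1)) ∧
    Summable (fun ℓ : ℕ => h ℓ 1)}

/-- Parameters of a Coxian representation with `n` phases, with the convention `p n = 0`. -/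
structure IsCoxian (n : ℕ) (μ p : ℕ → ℝ) : Prop where
  one_le : 1 ≤ n
  mu_pos : ∀ i : ℕ, 1 ≤ i → i ≤ n → 0 < μ i
  p_mem : ∀ i : ℕ, 1 ≤ i → i < n → 0 < p i ∧ p i < 1
  p_last : p n = 0

/-- `μ i * (1 - p i)` is decreasing (non-increasing) in `i ∈ {1, …, n}`. -/
def RatesDecreasing (n : ℕ) (μ p : ℕ → ℝ) : Prop :=
  ∀ i : ℕ, 1 ≤ i → i < n → μ (i + 1) * (1 - p (i + 1)) ≤ μ i * (1 - p i)

/-- Conventions on the functions `f ℓ i`: `f 1 i = 0` for `i ≥ 2` (these functions do not enter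
the ODE), and `f ℓ i = 0` beyond the buffer size. -/
def ArrivalConvention (n : ℕ) (B : ℕ∞) (f : ℕ → ℕ → Omega n B → ℝ) : Prop :=
  (∀ (i : ℕ) (h : Omega n B), 2 ≤ i → i ≤ n → f 1 i h = 0) ∧
  (∀ (ℓ i : ℕ) (h : Omega n B), B < (ℓ : ℕ∞) → 1 ≤ i → i ≤ n → f ℓ i h = 0)

/-- The right-hand side of the ODE for the component `(ℓ, i)`, `ℓ ≥ 1`, `1 ≤ i ≤ n`. -/
noncomputable def drift (n : ℕ) (B : ℕ∞) (μ p : ℕ → ℝ) (f : ℕ → ℕ → Omega n B → ℝ)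
    (h : Omega n B) (ℓ i : ℕ) : ℝ :=
  if i = 1 then
    f ℓ 1 h - ∑ j ∈ Finset.Icc 1 n,
      ((h.1 ℓ j - h.1 ℓ (j + 1)) - (h.1 (ℓ + 1) j - h.1 (ℓ + 1) (j + 1))) * (μ j * (1 - p j))
  else
    (if 1 < ℓ then f ℓ i h else 0) + (h.1 ℓ (i - 1) - h.1 ℓ i) * (p (i - 1) * μ (i - 1))
      - ∑ j ∈ Finset.Icc i n, (h.1 ℓ j - h.1 ℓ (j + 1)) * (μ j * (1 - p j))

/-- `h : [0, ∞) → Ω` solves the ODE, componentwise (values at negative times are irrelevant;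
the derivative at time `0` is one-sided). -/
def IsSolution (n : ℕ) (B : ℕ∞) (μ p : ℕ → ℝ) (f : ℕ → ℕ → Omega n B → ℝ)
    (h : ℝ → Omega n B) : Prop :=
  ∀ t : ℝ, 0 ≤ t → ∀ ℓ i : ℕ, 1 ≤ ℓ → 1 ≤ i → i ≤ n →
    HasDerivWithinAt (fun s : ℝ => (h s).1 ℓ i) (drift n B μ p f (h t) ℓ i) (Set.Ici 0) t

/-- Integers `L 1 ≥ L 2 ≥ … ≥ L n ≥ 1` with `L 1 > L n`. -/
def IsThreshold (n : ℕ) (L : ℕ → ℕ) : Prop :=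
  (∀ i : ℕ, 1 ≤ i → i < n → L (i + 1) ≤ L i) ∧ 1 ≤ L n ∧ L n < L 1

/-- `x (L 1) 1 + ∑_{i=2}^n (x (L i) i - x (L (i-1)) i)`: this is `g_L(h)` for `x = h`, and
`f_L(h)` for `x ℓ i = f ℓ i h`. -/
def thresholdSum (n : ℕ) (L : ℕ → ℕ) (x : ℕ → ℕ → ℝ) : ℝ :=
  x (L 1) 1 + ∑ i ∈ Finset.Icc 2 n, (x (L i) i - x (L (i - 1)) i)

/-- The componentwise order. -/
def LeComp {n : ℕ} {B : ℕ∞} (h h' : Omega n B) : Prop :=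
  ∀ ℓ i : ℕ, 1 ≤ ℓ → 1 ≤ i → i ≤ n → h.1 ℓ i ≤ h'.1 ℓ i

/-- The partial order `≤_C`. -/
def LeC {n : ℕ} {B : ℕ∞} (h h' : Omega n B) : Prop :=
  LeComp h h' ∧
  ∀ L : ℕ → ℕ, IsThreshold n L → thresholdSum n L h.1 ≤ thresholdSum n L h'.1

/-- Through every state there is exactly one solution on `[0, ∞)`, and a fixed point exists. -/
def UniqueSolutionsAndFixedPoint (n : ℕ) (B : ℕ∞) (μ p : ℕ → ℝ)
    (f : ℕ → ℕ → Omega n B → ℝ) : Prop :=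
  (∀ h₀ : Omega n B, ∃ h : ℝ → Omega n B, (IsSolution n B μ p f h ∧ h 0 = h₀) ∧
    ∀ k : ℝ → Omega n B, IsSolution n B μ p f k → k 0 = h₀ → ∀ t : ℝ, 0 ≤ t → k t = h t) ∧
  ∃ q : Omega n B, ∀ ℓ i : ℕ, 1 ≤ ℓ → 1 ≤ i → i ≤ n → drift n B μ p f q ℓ i = 0

/-- The drift is locally Lipschitz on the state space, for the supremum norm. -/
def DriftLocallyLipschitz (n : ℕ) (B : ℕ∞) (μ p : ℕ → ℝ)
    (f : ℕ → ℕ → Omega n B → ℝ) : Prop :=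
  ∀ h₀ : Omega n B, ∃ ε K : ℝ, 0 < ε ∧ 0 ≤ K ∧ ∀ h h' : Omega n B,
    (∀ ℓ i : ℕ, |h.1 ℓ i - h₀.1 ℓ i| ≤ ε) → (∀ ℓ i : ℕ, |h'.1 ℓ i - h₀.1 ℓ i| ≤ ε) →
    ∀ D : ℝ, (∀ ℓ i : ℕ, |h.1 ℓ i - h'.1 ℓ i| ≤ D) →
      ∀ ℓ i : ℕ, 1 ≤ ℓ → 1 ≤ i → i ≤ n →
        |drift n B μ p f h ℓ i - drift n B μ p f h' ℓ i| ≤ K * D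

/-- `f ℓ i` is non-decreasing in all the coordinates other than `(ℓ, i)`. -/
def MonotoneInOthers (n : ℕ) (B : ℕ∞) (f : ℕ → ℕ → Omega n B → ℝ) : Prop :=
  ∀ ℓ i : ℕ, 1 ≤ ℓ → 1 ≤ i → i ≤ n → ∀ h h' : Omega n B,
    LeComp h h' → h.1 ℓ i = h'.1 ℓ i → f ℓ i h ≤ f ℓ i h'

/-- `f_L(h) ≤ f_L(h')` whenever `h ≤_C h'` and `g_L(h) = g_L(h')`. -/
def MonotoneThreshold (n : ℕ) (B : ℕ∞) (f : ℕ → ℕ → Omega n B → ℝ) : Prop :=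
  ∀ L : ℕ → ℕ, IsThreshold n L → ∀ h h' : Omega n B,
    LeC h h' → thresholdSum n L h'.1 = thresholdSum n L h.1 →
      thresholdSum n L (fun ℓ i => f ℓ i h) ≤ thresholdSum n L (fun ℓ i => f ℓ i h')

end CoxMF

namespace CoxMF

open Filter Topology

/-! ### Threshold sums -/

/-! The order `≤_C` is an intersection of half-spaces `g_L(h) ≤ g_L(h')`, and the flow preserves it
because the drift is quasi-monotone: where `k ≤_C k'` and `g_L` is tight, `g_L` of the drift is
ordered as well (`thresholdSum_drift_le`). For arrivals this is assumed. The service part is linear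
in `z = k - k'`, and `L` maximises `g_L(z)`. Changing one entry of `L` shows that phase changes
contribute at most `0`; raising the first `m` entries gives nonnegative partial sums, which the
decreasing rates `μ i * (1 - p i)` combine by Abel summation (`thresholdSum_serviceDrift_nonpos`).

Allowing infinite leading entries in `L` puts the componentwise inequalities on the same footing: `h
ℓ i` is `g_L` for `L = (∞,…,∞,ℓ,…,ℓ)` (`leC_iff`). Quasi-monotonicity extends to these `L` by a
limit, since the drift vanishes at infinite length (`tendsto_drift_length`).

Quasi-monotonicity speaks only of ordered pairs. If the largest violation over the thresholds
bounded by `M` is a small `V > 0`, attained at `L`, both states can be moved by at most `V` to an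
ordered pair tight at `L` (`exists_leC_tight`). The local Lipschitz bound then makes the violation
grow at rate at most a constant times `V`, so it stays below a linear barrier started at `ε`.
Uniform tails reduce this to finitely many thresholds. Letting `ε → 0` gives the order on a short
interval (`exists_leC_Icc`), and a continuation argument does the rest. -/

lemma thresholdSum_congr {n : ℕ} (hn : 1 ≤ n) {L L' : ℕ → ℕ} (x : ℕ → ℕ → ℝ)
    (hL : ∀ i, 1 ≤ i → i ≤ n → L i = L' i) : thresholdSum n L x = thresholdSum n L' x := by
  unfold thresholdSum
  rw [hL 1 le_rfl hn]
  congr 1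
  refine Finset.sum_congr rfl fun i hi => ?_
  rw [Finset.mem_Icc] at hi
  rw [hL i (by lia) hi.2, hL (i - 1) (by lia) (by lia)]

lemma thresholdSum_congr_right {n : ℕ} (hn : 1 ≤ n) {L : ℕ → ℕ} {x y : ℕ → ℕ → ℝ}
    (h : ∀ i j, 1 ≤ j → j ≤ n → 1 ≤ i → i ≤ n → x (L i) j = y (L i) j) :
    thresholdSum n L x = thresholdSum n L y := by
  unfold thresholdSum
  rw [h 1 1 le_rfl hn le_rfl hn]
  congr 1
  refine Finset.sum_congr rfl fun i hi => ?_
  rw [Finset.mem_Icc] at hi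
  rw [h i i (by lia) hi.2 (by lia) hi.2, h (i - 1) i (by lia) (by lia) (by lia) (by lia)]

lemma thresholdSum_add (n : ℕ) (L : ℕ → ℕ) (x y : ℕ → ℕ → ℝ) :
    thresholdSum n L (fun ℓ i => x ℓ i + y ℓ i) = thresholdSum n L x + thresholdSum n L y := by
  unfold thresholdSum
  rw [add_add_add_comm, ← Finset.sum_add_distrib]
  congr 1
  exact Finset.sum_congr rfl fun i _ => by ring

lemma thresholdSum_const_mul (n : ℕ) (L : ℕ → ℕ) (a : ℝ) (x : ℕ → ℕ → ℝ) :
    thresholdSum n L (fun ℓ i => a * x ℓ i) = a * thresholdSum n L x := by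
  unfold thresholdSum
  rw [mul_add, Finset.mul_sum]
  congr 1
  exact Finset.sum_congr rfl fun i _ => by ring

lemma thresholdSum_sub (n : ℕ) (L : ℕ → ℕ) (x y : ℕ → ℕ → ℝ) :
    thresholdSum n L (fun ℓ i => x ℓ i - y ℓ i) = thresholdSum n L x - thresholdSum n L y := by
  have h := thresholdSum_add n L x (fun ℓ i => -1 * y ℓ i)
  rw [thresholdSum_const_mul] at h
  simpa [sub_eq_add_neg] using h

lemma thresholdSum_const {n : ℕ} (hn : 1 ≤ n) {L : ℕ → ℕ} (m : ℕ) (x : ℕ → ℕ → ℝ)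
    (hL : ∀ i, 1 ≤ i → i ≤ n → L i = m) : thresholdSum n L x = x m 1 := by
  rw [thresholdSum_congr hn (L' := fun _ => m) x hL]
  simp [thresholdSum]

/-- Summation by parts: each entry of `L` now enters a single summand, so the effect of modifying
entries of `L` can be read off term by term. -/
lemma thresholdSum_step {n : ℕ} (L : ℕ → ℕ) (x : ℕ → ℕ → ℝ) (hn : 1 ≤ n) :
    thresholdSum n L x
      = ∑ i ∈ Finset.Icc 1 n, (x (L i) i - x (L i) (i + 1)) + x (L n) (n + 1) := by
  induction n, hn using Nat.le_induction with
  | base => simp [thresholdSum]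
  | succ m hm ih =>
    unfold thresholdSum at ih ⊢
    rw [Finset.sum_Icc_succ_top (by lia), Finset.sum_Icc_succ_top (by lia), ← add_assoc, ih,
      Nat.add_sub_cancel]
    ring

lemma thresholdSum_eq_sum {n : ℕ} (hn : 1 ≤ n) (L : ℕ → ℕ) {x : ℕ → ℕ → ℝ}
    (hx : ∀ ℓ, x ℓ (n + 1) = 0) :
    thresholdSum n L x = ∑ i ∈ Finset.Icc 1 n, (x (L i) i - x (L i) (i + 1)) := by
  rw [thresholdSum_step L x hn, hx, add_zero]

lemma abs_thresholdSum_le {n : ℕ} (hn : 1 ≤ n) {L : ℕ → ℕ} {x : ℕ → ℕ → ℝ} {D : ℝ}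
    (hx : ∀ i j, 1 ≤ j → j ≤ n → 1 ≤ i → i ≤ n → |x (L i) j| ≤ D) :
    |thresholdSum n L x| ≤ 2 * n * D := by
  unfold thresholdSum
  have h1 := hx 1 1 le_rfl hn le_rfl hn
  have hD : 0 ≤ D := (abs_nonneg _).trans h1
  have h2 : |∑ i ∈ Finset.Icc 2 n, (x (L i) i - x (L (i - 1)) i)|
      ≤ (Finset.Icc 2 n).card • (2 * D) := by
    refine (Finset.abs_sum_le_sum_abs _ _).trans (Finset.sum_le_card_nsmul _ _ _ fun i hi => ?_)
    rw [Finset.mem_Icc] at hi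
    have := abs_sub (x (L i) i) (x (L (i - 1)) i)
    linarith [hx i i (by lia) (by lia) (by lia) (by lia),
      hx (i - 1) i (by lia) (by lia) (by lia) (by lia)]
  rw [Nat.card_Icc, nsmul_eq_mul, show n + 1 - 2 = n - 1 by lia, Nat.cast_sub hn] at h2
  have := abs_add_le (x (L 1) 1) (∑ i ∈ Finset.Icc 2 n, (x (L i) i - x (L (i - 1)) i))
  push_cast at h2
  nlinarith

/-! ### Quasi-monotonicity of the linear part of the drift -/

/-- The part of the drift that does not come from the arrival functions. -/
noncomputable def serviceDrift (n : ℕ) (μ p : ℕ → ℝ) (z : ℕ → ℕ → ℝ) (ℓ i : ℕ) : ℝ :=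
  if i = 1 then
    - ∑ j ∈ Finset.Icc 1 n,
      ((z ℓ j - z ℓ (j + 1)) - (z (ℓ + 1) j - z (ℓ + 1) (j + 1))) * (μ j * (1 - p j))
  else
    (z ℓ (i - 1) - z ℓ i) * (p (i - 1) * μ (i - 1))
      - ∑ j ∈ Finset.Icc i n, (z ℓ j - z ℓ (j + 1)) * (μ j * (1 - p j))

lemma serviceDrift_sub (n : ℕ) (μ p : ℕ → ℝ) (x y : ℕ → ℕ → ℝ) (ℓ i : ℕ) :
    serviceDrift n μ p (fun ℓ i => x ℓ i - y ℓ i) ℓ i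
      = serviceDrift n μ p x ℓ i - serviceDrift n μ p y ℓ i := by
  unfold serviceDrift
  split_ifs
  · rw [← neg_sub', ← Finset.sum_sub_distrib, neg_inj]
    exact Finset.sum_congr rfl fun i _ => by ring
  · refine Eq.trans ?_ (sub_sub_sub_comm _ _ _ _).symm
    rw [← Finset.sum_sub_distrib]
    congr 1
    · ring
    · exact Finset.sum_congr rfl fun i _ => by ring

lemma sum_Icc_two_sub_pred (a : ℕ → ℝ) {m : ℕ} (hm : 1 ≤ m) :
    ∑ i ∈ Finset.Icc 2 m, (a i - a (i - 1)) = a m - a 1 := by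
  induction m, hm using Nat.le_induction with
  | base => simp
  | succ m hm ih => rw [Finset.sum_Icc_succ_top (by lia), ih]; simp

/-- After exchanging the two sums, completions in phase `j` telescope over `i` from `L 1` to `L j`;
the phase-one component then replaces `L 1` by `L 1 + 1`. -/
lemma thresholdSum_serviceDrift {n : ℕ} (μ p : ℕ → ℝ) (L : ℕ → ℕ) (z : ℕ → ℕ → ℝ) :
    thresholdSum n L (serviceDrift n μ p z)
      = ∑ i ∈ Finset.Icc 2 n,
          ((z (L i) (i - 1) - z (L i) i) - (z (L (i - 1)) (i - 1) - z (L (i - 1)) i))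
            * (p (i - 1) * μ (i - 1))
        - ∑ j ∈ Finset.Icc 1 n,
          (μ j * (1 - p j)) *
            ((z (L j) j - z (L j) (j + 1)) - (z (L 1 + 1) j - z (L 1 + 1) (j + 1))) := by
  have key : ∑ i ∈ Finset.Icc 2 n, ∑ j ∈ Finset.Icc i n,
      ((z (L i) j - z (L i) (j + 1)) - (z (L (i - 1)) j - z (L (i - 1)) (j + 1)))
        * (μ j * (1 - p j))
      = ∑ j ∈ Finset.Icc 1 n,
        ((z (L j) j - z (L j) (j + 1)) - (z (L 1) j - z (L 1) (j + 1))) * (μ j * (1 - p j)) := by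
    rw [Finset.sum_comm' (t' := Finset.Icc 1 n) (s' := fun j => Finset.Icc 2 j)
      (by intro x y; simp only [Finset.mem_Icc]; lia)]
    refine Finset.sum_congr rfl fun j hj => ?_
    rw [Finset.mem_Icc] at hj
    rw [← Finset.sum_mul, sum_Icc_two_sub_pred (fun i => z (L i) j - z (L i) (j + 1)) hj.1]
  have e1 : ∀ ℓ, serviceDrift n μ p z ℓ 1 = - ∑ j ∈ Finset.Icc 1 n,
      ((z ℓ j - z ℓ (j + 1)) - (z (ℓ + 1) j - z (ℓ + 1) (j + 1))) * (μ j * (1 - p j)) :=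
    fun ℓ => by simp [serviceDrift]
  have e2 : ∑ i ∈ Finset.Icc 2 n,
      (serviceDrift n μ p z (L i) i - serviceDrift n μ p z (L (i - 1)) i)
      = ∑ i ∈ Finset.Icc 2 n,
          (((z (L i) (i - 1) - z (L i) i) - (z (L (i - 1)) (i - 1) - z (L (i - 1)) i))
            * (p (i - 1) * μ (i - 1)) - ∑ j ∈ Finset.Icc i n,
      ((z (L i) j - z (L i) (j + 1)) - (z (L (i - 1)) j - z (L (i - 1)) (j + 1)))
        * (μ j * (1 - p j))) := by
    refine Finset.sum_congr rfl fun i hi => ?_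
    rw [Finset.mem_Icc] at hi
    have : i ≠ 1 := by lia
    simp only [serviceDrift, if_neg this]
    rw [sub_sub_sub_comm, ← Finset.sum_sub_distrib, ← sub_mul]
    congr 1
    exact Finset.sum_congr rfl fun j _ => by ring
  unfold thresholdSum
  rw [e1, e2, Finset.sum_sub_distrib, key, neg_add_eq_sub, sub_sub, ← Finset.sum_add_distrib]
  congr 1
  exact Finset.sum_congr rfl fun j _ => by ring

/-- Abel's inequality; the individual `d i` may have any sign. -/
lemma mul_sum_le_sum_mul_of_antitone {c d : ℕ → ℝ} {n : ℕ} (hn : 1 ≤ n)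
    (hc : ∀ i, 1 ≤ i → i < n → c (i + 1) ≤ c i)
    (hd : ∀ m, 1 ≤ m → m ≤ n → 0 ≤ ∑ i ∈ Finset.Icc 1 m, d i) :
    c n * ∑ i ∈ Finset.Icc 1 n, d i ≤ ∑ i ∈ Finset.Icc 1 n, c i * d i := by
  induction n, hn using Nat.le_induction with
  | base => simp
  | succ m hm ih =>
    have h := ih (fun i hi him => hc i hi (by lia)) (fun k hk hkm => hd k hk (by lia))
    rw [Finset.sum_Icc_succ_top (by lia), Finset.sum_Icc_succ_top (by lia)]
    have h1 := hc m hm (by lia)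
    have h2 := hd m hm (by lia)
    nlinarith [mul_le_mul_of_nonneg_right h1 h2]

/-- Finite thresholds, including the constant ones. -/
def IsFinThreshold (n : ℕ) (L : ℕ → ℕ) : Prop :=
  (∀ i, 1 ≤ i → i < n → L (i + 1) ≤ L i) ∧ 1 ≤ L n

lemma IsFinThreshold.antitone {n : ℕ} {L : ℕ → ℕ} (hL : IsFinThreshold n L) {i j : ℕ}
    (hi : 1 ≤ i) (hij : i ≤ j) (hj : j ≤ n) : L j ≤ L i := by
  induction j, hij using Nat.le_induction with
  | base => rfl
  | succ m hm ih => exact (hL.1 m (by lia) (by lia)).trans (ih (by lia))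

lemma IsFinThreshold.one_le {n : ℕ} {L : ℕ → ℕ} (hL : IsFinThreshold n L) {i : ℕ}
    (hi : 1 ≤ i) (hin : i ≤ n) : 1 ≤ L i :=
  hL.2.trans (hL.antitone hi hin le_rfl)

lemma IsFinThreshold.const_or_isThreshold {n : ℕ} {L : ℕ → ℕ} (hn : 1 ≤ n)
    (hL : IsFinThreshold n L) : (∀ i, 1 ≤ i → i ≤ n → L i = L 1) ∨ IsThreshold n L := by
  rcases (hL.antitone le_rfl hn le_rfl).lt_or_eq with h | h
  · exact Or.inr ⟨hL.1, hL.2, h⟩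
  · refine Or.inl fun i hi hin => le_antisymm (hL.antitone le_rfl hi hin) ?_
    rw [← h]; exact hL.antitone hi hin le_rfl

theorem thresholdSum_serviceDrift_nonpos {n : ℕ} {μ p : ℕ → ℝ} (hcox : IsCoxian n μ p)
    (hdec : RatesDecreasing n μ p) {z : ℕ → ℕ → ℝ} (hz : ∀ ℓ, z ℓ (n + 1) = 0)
    (hle : ∀ L, IsFinThreshold n L → thresholdSum n L z ≤ 0)
    {L : ℕ → ℕ} (hL : IsFinThreshold n L) (h0 : thresholdSum n L z = 0) :
    thresholdSum n L (serviceDrift n μ p z) ≤ 0 := by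
  have hn := hcox.one_le
  rw [thresholdSum_eq_sum hn L hz] at h0
  rw [thresholdSum_serviceDrift]
  have hphase : ∀ i ∈ Finset.Icc 2 n,
      ((z (L i) (i - 1) - z (L i) i) - (z (L (i - 1)) (i - 1) - z (L (i - 1)) i))
            * (p (i - 1) * μ (i - 1)) ≤ 0 := by
    intro i hi
    obtain ⟨k, rfl⟩ : ∃ k, i = k + 1 := ⟨i - 1, by rw [Finset.mem_Icc] at hi; lia⟩
    rw [Finset.mem_Icc] at hi
    simp only [Nat.add_sub_cancel]
    refine mul_nonpos_of_nonpos_of_nonneg ?_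
      (mul_nonneg (hcox.p_mem k (by lia) (by lia)).1.le (hcox.mu_pos k (by lia) (by lia)).le)
    -- Lowering entry `k` to the next one gives an admissible threshold and changes only summand
    -- `k`. As `g_L(z) = 0` is maximal, the change is at most `0`.
    have hL' : IsFinThreshold n (Function.update L k (L (k + 1))) := by
      refine ⟨fun j hj hjn => ?_, ?_⟩
      · by_cases h1 : j = k
        · subst h1; simp
        · rw [Function.update_of_ne h1]
          by_cases h2 : j + 1 = k
          · rw [h2, Function.update_self]
            exact hL.antitone hj (by lia) (by lia)
          · rw [Function.update_of_ne h2]; exact hL.1 j hj hjn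
      · rw [Function.update_of_ne (by lia)]; exact hL.2
    have h1 := hle _ hL'
    rw [thresholdSum_eq_sum hn _ hz] at h1
    have h2 : ∑ i ∈ Finset.Icc 1 n, ((z (Function.update L k (L (k + 1)) i) i
        - z (Function.update L k (L (k + 1)) i) (i + 1)) - (z (L i) i - z (L i) (i + 1)))
        = (z (L (k + 1)) k - z (L (k + 1)) (k + 1)) - (z (L k) k - z (L k) (k + 1)) := by
      rw [Finset.sum_eq_single_of_mem k (by rw [Finset.mem_Icc]; lia)]
      · simp
      · intro j _ hj
        rw [Function.update_of_ne hj, sub_self]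
    rw [Finset.sum_sub_distrib] at h2
    linarith
  have hserv : μ n * (1 - p n) * ∑ j ∈ Finset.Icc 1 n,
      ((z (L j) j - z (L j) (j + 1)) - (z (L 1 + 1) j - z (L 1 + 1) (j + 1)))
      ≤ ∑ j ∈ Finset.Icc 1 n, (μ j * (1 - p j)) *
            ((z (L j) j - z (L j) (j + 1)) - (z (L 1 + 1) j - z (L 1 + 1) (j + 1))) ∧
      0 ≤ ∑ j ∈ Finset.Icc 1 n,
      ((z (L j) j - z (L j) (j + 1)) - (z (L 1 + 1) j - z (L 1 + 1) (j + 1))) := by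
    have hpart : ∀ m, 1 ≤ m → m ≤ n → 0 ≤ ∑ j ∈ Finset.Icc 1 m,
        ((z (L j) j - z (L j) (j + 1)) - (z (L 1 + 1) j - z (L 1 + 1) (j + 1))) := by
      intro m hm hmn
      -- Raising the first `m` entries to `L 1 + 1` keeps the threshold non-increasing; by
      -- maximality of `g_L(z) = 0` the resulting loss, which is the `m`-th partial sum, is
      -- nonnegative.
      set L' : ℕ → ℕ := fun j => if j ≤ m then L 1 + 1 else L j with hLdef
      have hL' : IsFinThreshold n L' := by
        refine ⟨fun j hj hjn => ?_, ?_⟩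
        · have := hL.antitone le_rfl (show 1 ≤ j + 1 by lia) (by lia)
          have := hL.1 j hj hjn
          simp only [hLdef]
          split_ifs <;> lia
        · have := hL.2
          simp only [hLdef]
          split_ifs <;> lia
      have h1 := hle _ hL'
      rw [thresholdSum_eq_sum hn _ hz] at h1
      have h2 : ∑ j ∈ Finset.Icc 1 m,
          ((z (L j) j - z (L j) (j + 1)) - (z (L 1 + 1) j - z (L 1 + 1) (j + 1)))
          = ∑ j ∈ Finset.Icc 1 n,
          ((z (L j) j - z (L j) (j + 1)) - (z (L' j) j - z (L' j) (j + 1))) := by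
        rw [← Finset.sum_subset (Finset.Icc_subset_Icc_right hmn)]
        · refine Finset.sum_congr rfl fun j hj => ?_
          rw [Finset.mem_Icc] at hj
          simp [hLdef, hj.2]
        · intro j hj hj'
          rw [Finset.mem_Icc] at hj hj'
          simp [hLdef, show ¬ j ≤ m by lia]
      rw [h2, Finset.sum_sub_distrib]
      linarith
    exact ⟨mul_sum_le_sum_mul_of_antitone (c := fun j => μ j * (1 - p j)) hn hdec hpart,
      hpart n hn le_rfl⟩
  have h3 : 0 ≤ μ n * (1 - p n) := by
    rw [hcox.p_last]; linarith [hcox.mu_pos n hn le_rfl]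
  have := mul_nonneg h3 hserv.2
  linarith [Finset.sum_nonpos hphase, hserv.1]

/-! ### The state space -/

namespace Omega

variable {n : ℕ} {B : ℕ∞} (h : Omega n B)

lemma apply_zero (i : ℕ) : h.1 0 i = 0 := h.2.1 0 i (Or.inl rfl)

lemma apply_succ_phase (ℓ : ℕ) : h.1 ℓ (n + 1) = 0 :=
  h.2.1 ℓ (n + 1) (Or.inr (Or.inr (Or.inl (by lia))))

lemma cases_index (ℓ i : ℕ) : h.1 ℓ i = 0 ∨ (1 ≤ ℓ ∧ 1 ≤ i ∧ i ≤ n) := by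
  by_cases hi : 1 ≤ ℓ ∧ 1 ≤ i ∧ i ≤ n
  · exact Or.inr hi
  · refine Or.inl (h.2.1 ℓ i ?_)
    by_contra hc
    push Not at hc
    exact hi ⟨by lia, by lia, by lia⟩

lemma nonneg (ℓ i : ℕ) : 0 ≤ h.1 ℓ i := by
  rcases cases_index h ℓ i with h0 | ⟨h1, h2, h3⟩
  · exact h0.ge
  · exact (h.2.2.1 ℓ i h1 h2 h3).1

lemma le_one (ℓ i : ℕ) : h.1 ℓ i ≤ 1 := by
  rcases cases_index h ℓ i with h0 | ⟨h1, h2, h3⟩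
  · rw [h0]; exact zero_le_one
  · exact (h.2.2.1 ℓ i h1 h2 h3).2.1

lemma antitone_length {ℓ m : ℕ} (hℓ : 1 ≤ ℓ) (hm : ℓ ≤ m) (i : ℕ) : h.1 m i ≤ h.1 ℓ i := by
  induction m, hm using Nat.le_induction with
  | base => rfl
  | succ m hm ih =>
    refine le_trans ?_ ih
    rcases cases_index h (m + 1) i with h0 | ⟨h1, h2, h3⟩
    · rw [h0]; exact nonneg h m i
    · exact (h.2.2.1 m i (by lia) h2 h3).2.2.2.1

lemma le_first (ℓ i : ℕ) : h.1 ℓ i ≤ h.1 ℓ 1 := by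
  rcases cases_index h ℓ i with h0 | ⟨h1, h2, h3⟩
  · rw [h0]; exact nonneg h ℓ 1
  · clear h1
    induction i, h2 using Nat.le_induction with
    | base => rfl
    | succ m hm ih =>
      refine le_trans ?_ (ih (by lia))
      rcases cases_index h ℓ m with h0 | ⟨h1, h2, h3⟩
      · rcases cases_index h ℓ (m + 1) with h0' | ⟨h1', h2', h3'⟩
        · rw [h0, h0']
        · exact (h.2.2.1 ℓ m h1' hm (by lia)).2.2.1
      · exact (h.2.2.1 ℓ m h1 h2 h3).2.2.1

lemma le_of_le {m ℓ : ℕ} (hm : 1 ≤ m) (hℓ : m ≤ ℓ) (i : ℕ) : h.1 ℓ i ≤ h.1 m 1 :=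
  (le_first h ℓ i).trans (antitone_length h hm hℓ 1)

lemma tendsto_length (i : ℕ) : Tendsto (fun N => h.1 N i) atTop (𝓝 0) :=
  squeeze_zero (fun N => nonneg h N i) (fun N => le_first h N i) h.2.2.2.tendsto_atTop_zero

end Omega

/-! ### Extended thresholds -/

/-- Thresholds in which leading entries may be infinite; the value `∞` is encoded by `0`, since
states vanish at length `0`. -/
def IsExtThreshold (n : ℕ) (L : ℕ → ℕ) : Prop :=
  ∀ i : ℕ, 1 ≤ i → i < n → L i ≠ 0 → L (i + 1) ≠ 0 ∧ L (i + 1) ≤ L i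

/-- Replace the infinite entries of an extended threshold by `N`. -/
def fillThreshold (N : ℕ) (L : ℕ → ℕ) (i : ℕ) : ℕ := if L i = 0 then N else L i

lemma IsExtThreshold.fill {n N : ℕ} {L : ℕ → ℕ} (hL : IsExtThreshold n L)
    (hN : ∀ i, 1 ≤ i → i ≤ n → L i ≤ N) (hN1 : 1 ≤ N) :
    IsFinThreshold n (fillThreshold N L) := by
  refine ⟨fun i hi hin => ?_, ?_⟩
  · have h1 := hL i hi hin
    have h2 := hN (i + 1) (by lia) (by lia)
    unfold fillThreshold
    split_ifs <;> lia
  · unfold fillThreshold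
    split_ifs <;> lia

lemma IsFinThreshold.isExtThreshold {n : ℕ} {L : ℕ → ℕ} (hL : IsFinThreshold n L) :
    IsExtThreshold n L := fun i hi hin _ =>
  ⟨Nat.one_le_iff_ne_zero.1 (hL.one_le (by lia) (by lia)), hL.1 i hi hin⟩

lemma eventually_isFinThreshold_fill {n : ℕ} {L : ℕ → ℕ}
    (hL : IsExtThreshold n L) : ∀ᶠ N in atTop, IsFinThreshold n (fillThreshold N L) := by
  filter_upwards [eventually_ge_atTop ((Finset.Icc 1 n).sup L + 1)] with N hN
  refine hL.fill (fun i hi hin => ?_) (by lia)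
  have : L i ≤ (Finset.Icc 1 n).sup L := Finset.le_sup (Finset.mem_Icc.2 ⟨hi, hin⟩)
  lia

lemma tendsto_thresholdSum_fill {n : ℕ} (hn : 1 ≤ n) (L : ℕ → ℕ) {x : ℕ → ℕ → ℝ}
    (hx0 : ∀ i, x 0 i = 0)
    (hx : ∀ i, 1 ≤ i → i ≤ n → Tendsto (fun N => x N i) atTop (𝓝 0)) :
    Tendsto (fun N => thresholdSum n (fillThreshold N L) x) atTop (𝓝 (thresholdSum n L x)) := by
  have key : ∀ j i, 1 ≤ i → i ≤ n →
      Tendsto (fun N => x (fillThreshold N L j) i) atTop (𝓝 (x (L j) i)) := by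
    intro j i hi hin
    unfold fillThreshold
    by_cases hj : L j = 0
    · simp only [hj, if_true, hx0]; exact hx i hi hin
    · simp only [hj, if_false]; exact tendsto_const_nhds
  unfold thresholdSum
  refine (key 1 1 le_rfl hn).add (tendsto_finsetSum _ fun i hi => ?_)
  rw [Finset.mem_Icc] at hi
  exact (key i i (by lia) hi.2).sub (key (i - 1) i (by lia) hi.2)

lemma thresholdSum_tail {n : ℕ} (x : ℕ → ℕ → ℝ) (hx0 : ∀ i, x 0 i = 0) (ℓ : ℕ) {i : ℕ}
    (hi : 1 ≤ i) (hin : i ≤ n) :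
    thresholdSum n (fun j => if j < i then 0 else ℓ) x = x ℓ i := by
  unfold thresholdSum
  rcases hi.eq_or_lt with rfl | hi
  · rw [Finset.sum_eq_zero]
    · simp
    · intro j hj
      rw [Finset.mem_Icc] at hj
      simp [show j ≠ 0 by lia, show j - 1 ≠ 0 by lia]
  · rw [Finset.sum_eq_single_of_mem i (by rw [Finset.mem_Icc]; lia)]
    · simp [hi, hx0, show 0 < i by lia]
    · intro j hj hji
      rw [Finset.mem_Icc] at hj
      by_cases h1 : j < i
      · simp [h1, show j - 1 < i by lia]
      · simp [h1, show ¬ j - 1 < i by lia]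

lemma LeC.thresholdSum_le {n : ℕ} {B : ℕ∞} {h h' : Omega n B} (hn : 1 ≤ n) (hle : LeC h h')
    {L : ℕ → ℕ} (hL : IsFinThreshold n L) : thresholdSum n L h.1 ≤ thresholdSum n L h'.1 := by
  rcases hL.const_or_isThreshold hn with hc | ht
  · rw [thresholdSum_const hn _ _ hc, thresholdSum_const hn _ _ hc]
    exact hle.1 _ _ (hL.one_le le_rfl hn) le_rfl hn
  · exact hle.2 L ht

/-- Infinite entries are limits of large finite ones, as states vanish at infinite length;
conversely the threshold `(∞,…,∞,ℓ,…,ℓ)`, with `i - 1` infinite entries, isolates the coordinate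
`(ℓ, i)`. -/
theorem leC_iff {n : ℕ} {B : ℕ∞} {h h' : Omega n B} (hn : 1 ≤ n) :
    LeC h h' ↔ ∀ L, IsExtThreshold n L → thresholdSum n L h.1 ≤ thresholdSum n L h'.1 := by
  constructor
  · intro hle L hL
    refine le_of_tendsto_of_tendsto
      (tendsto_thresholdSum_fill hn L (Omega.apply_zero h) fun i _ _ => Omega.tendsto_length h i)
      (tendsto_thresholdSum_fill hn L (Omega.apply_zero h') fun i _ _ => Omega.tendsto_length h' i) ?_
    filter_upwards [eventually_isFinThreshold_fill hL] with N hN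
    exact hle.thresholdSum_le hn hN
  · intro H
    refine ⟨fun ℓ i hℓ hi hin => ?_, fun L hL => H L ?_⟩
    · have := H (fun j => if j < i then 0 else ℓ) (by
        intro j _ _ hj0
        have hj1 : ¬ j < i := fun hc => hj0 (by simp [hc])
        simp [hj1, show ¬ j + 1 < i by lia]
        lia)
      rwa [thresholdSum_tail h.1 (Omega.apply_zero h) ℓ hi hin,
        thresholdSum_tail h'.1 (Omega.apply_zero h') ℓ hi hin] at this
    · exact IsFinThreshold.isExtThreshold ⟨hL.1, hL.2.1⟩

/-! ### Quasi-monotonicity of the drift -/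

lemma drift_eq {n : ℕ} {B : ℕ∞} {μ p : ℕ → ℝ} {f : ℕ → ℕ → Omega n B → ℝ}
    (hconv : ArrivalConvention n B f) (h : Omega n B) {ℓ i : ℕ} (hℓ : 1 ≤ ℓ) (hi : 1 ≤ i)
    (hin : i ≤ n) :
    drift n B μ p f h ℓ i = f ℓ i h + serviceDrift n μ p h.1 ℓ i := by
  unfold drift serviceDrift
  by_cases h1 : i = 1
  · simp only [h1, if_true]; ring
  · have : (if 1 < ℓ then f ℓ i h else 0) = f ℓ i h := by
      split_ifs with hl
      · rfl
      · rw [show ℓ = 1 by lia, hconv.1 i h (by lia) hin]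
    rw [if_neg h1, if_neg h1, this]; ring

theorem thresholdSum_drift_le {n : ℕ} {B : ℕ∞} {μ p : ℕ → ℝ} {f : ℕ → ℕ → Omega n B → ℝ}
    (hcox : IsCoxian n μ p) (hconv : ArrivalConvention n B f) (h2 : MonotoneInOthers n B f)
    (h3 : MonotoneThreshold n B f) (hdec : RatesDecreasing n μ p) {k k' : Omega n B}
    (hle : LeC k k') {L : ℕ → ℕ} (hL : IsFinThreshold n L)
    (heq : thresholdSum n L k.1 = thresholdSum n L k'.1) :
    thresholdSum n L (drift n B μ p f k) ≤ thresholdSum n L (drift n B μ p f k') := by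
  have hn := hcox.one_le
  have split : ∀ k : Omega n B, thresholdSum n L (drift n B μ p f k)
      = thresholdSum n L (fun ℓ i => f ℓ i k) + thresholdSum n L (serviceDrift n μ p k.1) := by
    intro k
    rw [← thresholdSum_add]
    exact thresholdSum_congr_right hn fun i j hj hjn hi hin =>
      drift_eq hconv k (hL.one_le hi hin) hj hjn
  have hf : thresholdSum n L (fun ℓ i => f ℓ i k) ≤ thresholdSum n L (fun ℓ i => f ℓ i k') := by
    rcases hL.const_or_isThreshold hn with hc | ht
    -- A constant threshold `m` is the coordinate `(m, 1)`, so coordinatewise monotonicity of `f`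
    -- applies.
    · rw [thresholdSum_const hn _ _ hc, thresholdSum_const hn _ _ hc] at heq ⊢
      exact h2 _ _ (hL.one_le le_rfl hn) le_rfl hn k k' hle.1 heq
    · exact h3 L ht k k' hle heq.symm
  have hs := thresholdSum_serviceDrift_nonpos hcox hdec
    (z := fun ℓ i => k.1 ℓ i - k'.1 ℓ i)
    (fun ℓ => by rw [Omega.apply_succ_phase k, Omega.apply_succ_phase k', sub_zero])
    (fun L' hL' => by
      rw [thresholdSum_sub]
      linarith [hle.thresholdSum_le hn hL'])
    hL (by rw [thresholdSum_sub, heq, sub_self])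
  have e : serviceDrift n μ p (fun ℓ i => k.1 ℓ i - k'.1 ℓ i)
      = fun ℓ i => serviceDrift n μ p k.1 ℓ i - serviceDrift n μ p k'.1 ℓ i := by
    funext ℓ i; exact serviceDrift_sub n μ p k.1 k'.1 ℓ i
  rw [e, thresholdSum_sub] at hs
  rw [split, split]
  linarith

/-! ### Continuity of solutions in the supremum norm -/

/-- Coordinatewise continuity becomes uniform because the single coordinate `(N, 1)` dominates all
those of length at least `N`; only finitely many others remain. -/
lemma IsSolution.eventually_abs_sub_le {n : ℕ} {B : ℕ∞} {μ p : ℕ → ℝ}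
    {f : ℕ → ℕ → Omega n B → ℝ} {u : ℝ → Omega n B} (hu : IsSolution n B μ p f u)
    {t : ℝ} (ht : 0 ≤ t) {r : ℝ} (hr : 0 < r) :
    ∀ᶠ s in 𝓝[Set.Ici 0] t, ∀ ℓ i : ℕ, |(u s).1 ℓ i - (u t).1 ℓ i| ≤ r := by
  have hcont : ∀ ℓ i, ContinuousWithinAt (fun s => (u s).1 ℓ i) (Set.Ici 0) t := by
    intro ℓ i
    by_cases hi : 1 ≤ ℓ ∧ 1 ≤ i ∧ i ≤ n
    · exact (hu t ht ℓ i hi.1 hi.2.1 hi.2.2).continuousWithinAt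
    · have : (fun s => (u s).1 ℓ i) = fun _ => 0 :=
        funext fun s => (Omega.cases_index (u s) ℓ i).resolve_right hi
      rw [this]; exact continuousWithinAt_const
  have hclose : ∀ ℓ i, ∀ᶠ s in 𝓝[Set.Ici 0] t, |(u s).1 ℓ i - (u t).1 ℓ i| ≤ r / 2 := by
    intro ℓ i
    filter_upwards [Metric.tendsto_nhds.1 (hcont ℓ i) (r / 2) (by linarith)] with s hs
    exact hs.le
  obtain ⟨N, hN, hN1⟩ := ((Omega.tendsto_length (u t) 1).eventually_lt_const
    (show (0 : ℝ) < r / 2 by linarith)).and (eventually_ge_atTop 1) |>.exists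
  have hfin : ∀ᶠ s in 𝓝[Set.Ici 0] t, ∀ a ∈ Finset.range (N + 1) ×ˢ Finset.range (n + 1),
      |(u s).1 a.1 a.2 - (u t).1 a.1 a.2| ≤ r / 2 :=
    (Filter.eventually_all_finset _).2 fun a _ => hclose a.1 a.2
  filter_upwards [hfin, hclose N 1] with s hs hs1 ℓ i
  by_cases hi : i ≤ n
  · by_cases hℓ : ℓ ≤ N
    · have := hs (ℓ, i) (by simp; lia)
      linarith
    · have h1 := Omega.le_of_le (u s) hN1 (show N ≤ ℓ by lia) i
      have h2 := Omega.le_of_le (u t) hN1 (show N ≤ ℓ by lia) i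
      have h3 := Omega.nonneg (u s) ℓ i
      have h4 := Omega.nonneg (u t) ℓ i
      rw [abs_le] at hs1 ⊢
      constructor <;> linarith
  · rw [(Omega.cases_index (u s) ℓ i).resolve_right (by lia),
      (Omega.cases_index (u t) ℓ i).resolve_right (by lia)]
    simpa using hr.le

/-- Invariance of the state space forces the drift to vanish at infinite queue length. -/
theorem tendsto_drift_length {n : ℕ} {B : ℕ∞} {μ p : ℕ → ℝ} {f : ℕ → ℕ → Omega n B → ℝ}
    (hlip : DriftLocallyLipschitz n B μ p f) (h1 : UniqueSolutionsAndFixedPoint n B μ p f)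
    (k : Omega n B) {i : ℕ} (hi : 1 ≤ i) (hin : i ≤ n) :
    Tendsto (fun N => drift n B μ p f k N i) atTop (𝓝 0) := by
  obtain ⟨u, ⟨hu, rfl⟩, -⟩ := h1.1 k
  obtain ⟨ε, K, hε, hK, hL⟩ := hlip (u 0)
  rw [Metric.tendsto_nhds]
  intro η hη
  set r : ℝ := min ε (η / (4 * (K + 1))) with hrdef
  have hr : 0 < r := lt_min hε (by positivity)
  have hKr : K * r ≤ η / 4 := by
    have h1 : r ≤ η / (4 * (K + 1)) := min_le_right _ _
    rw [le_div_iff₀ (by positivity)] at h1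
    nlinarith
  obtain ⟨δ, hδ, hball⟩ := Metric.mem_nhdsWithin_iff.1
    (hu.eventually_abs_sub_le le_rfl hr)
  have hin' : ∀ s, 0 ≤ s → s ≤ δ / 2 → ∀ ℓ i : ℕ, |(u s).1 ℓ i - (u 0).1 ℓ i| ≤ r := by
    intro s hs0 hs
    refine hball ⟨?_, hs0⟩
    rw [Metric.mem_ball, Real.dist_eq, sub_zero, abs_of_nonneg hs0]
    linarith
  -- Over time `δ / 2` the solution follows its initial drift with an error uniform in `N`. Both end
  -- states vanish as `N → ∞`, so the drift must become small too.
  have hest : ∀ N, 1 ≤ N → |(u (δ / 2)).1 N i - (u 0).1 N i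
      - δ / 2 * drift n B μ p f (u 0) N i| ≤ K * r * (δ / 2) := by
    intro N hN
    have hder : ∀ s ∈ Set.Icc (0 : ℝ) (δ / 2), HasDerivWithinAt
        (fun s => (u s).1 N i - s * drift n B μ p f (u 0) N i)
        (drift n B μ p f (u s) N i - 1 * drift n B μ p f (u 0) N i)
        (Set.Icc (0 : ℝ) (δ / 2)) s := by
      intro s hs
      exact ((hu s hs.1 N i hN hi hin).mono Set.Icc_subset_Ici_self).sub
        ((hasDerivWithinAt_id s _).mul_const _)
    have := (convex_Icc (0 : ℝ) (δ / 2)).norm_image_sub_le_of_norm_hasDerivWithin_le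
      (C := K * r) hder (fun s hs => by
        rw [one_mul]
        exact hL (u s) (u 0)
          (fun ℓ j => (hin' s hs.1 hs.2 ℓ j).trans (min_le_left _ _))
          (fun ℓ j => by simpa using hε.le) r (hin' s hs.1 hs.2) N i hN hi hin)
      (x := 0) (y := δ / 2) ⟨le_rfl, by linarith⟩ ⟨by linarith, le_rfl⟩
    simp only [Real.norm_eq_abs, sub_zero, zero_mul] at this
    rw [abs_of_pos (show 0 < δ / 2 by linarith)] at this
    convert this using 2
    ring
  have hsmall : 0 < δ / 2 * (η / 4) := by positivity
  filter_upwards [(Omega.tendsto_length (u 0) i).eventually_lt_const hsmall,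
    (Omega.tendsto_length (u (δ / 2)) i).eventually_lt_const hsmall,
    eventually_ge_atTop 1] with N hN0 hNδ hN1
  have h2 := abs_le.1 (hest N hN1)
  have h3 := Omega.nonneg (u 0) N i
  have h4 := Omega.nonneg (u (δ / 2)) N i
  have h5 : K * r * (δ / 2) ≤ η / 4 * (δ / 2) := by gcongr
  rw [Real.dist_eq, sub_zero, abs_lt]
  constructor <;> by_contra hc <;> push Not at hc <;>
    nlinarith [mul_le_mul_of_nonneg_left hc (show 0 ≤ δ / 2 by linarith),
      mul_pos (show 0 < δ / 2 by linarith) hη]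

/-- The drift, continued by `0` to length `0`, which encodes infinite length. -/
noncomputable def extDrift (n : ℕ) (B : ℕ∞) (μ p : ℕ → ℝ) (f : ℕ → ℕ → Omega n B → ℝ)
    (h : Omega n B) (ℓ i : ℕ) : ℝ := if ℓ = 0 then 0 else drift n B μ p f h ℓ i

/-- Vanishing beyond `M` makes the filled thresholds exactly tight for `N > M`, and not merely in
the limit, so the finite case applies before passing to the limit. -/
theorem thresholdSum_extDrift_le {n : ℕ} {B : ℕ∞} {μ p : ℕ → ℝ} {f : ℕ → ℕ → Omega n B → ℝ}
    (hcox : IsCoxian n μ p) (hconv : ArrivalConvention n B f)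
    (hlip : DriftLocallyLipschitz n B μ p f) (h1 : UniqueSolutionsAndFixedPoint n B μ p f)
    (h2 : MonotoneInOthers n B f) (h3 : MonotoneThreshold n B f) (hdec : RatesDecreasing n μ p)
    {k k' : Omega n B} (hle : LeC k k') {M : ℕ} (hk : ∀ ℓ i, M < ℓ → k.1 ℓ i = 0)
    (hk' : ∀ ℓ i, M < ℓ → k'.1 ℓ i = 0) {L : ℕ → ℕ} (hL : IsExtThreshold n L)
    (heq : thresholdSum n L k.1 = thresholdSum n L k'.1) :
    thresholdSum n L (extDrift n B μ p f k) ≤ thresholdSum n L (extDrift n B μ p f k') := by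
  have hn := hcox.one_le
  have hlim : ∀ k : Omega n B, Tendsto
      (fun N => thresholdSum n (fillThreshold N L) (extDrift n B μ p f k)) atTop
      (𝓝 (thresholdSum n L (extDrift n B μ p f k))) := by
    intro k
    refine tendsto_thresholdSum_fill hn L (fun i => by simp [extDrift]) fun i hi hin => ?_
    refine (tendsto_drift_length hlip h1 k hi hin).congr' ?_
    filter_upwards [eventually_ge_atTop 1] with N hN
    rw [extDrift, if_neg (by lia)]
  have hfill : ∀ k : Omega n B, (∀ ℓ i, M < ℓ → k.1 ℓ i = 0) → ∀ N, M < N →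
      thresholdSum n (fillThreshold N L) k.1 = thresholdSum n L k.1 := by
    intro k hk N hN
    have : ∀ i j, k.1 (fillThreshold N L i) j = k.1 (L i) j := by
      intro i j
      unfold fillThreshold
      split_ifs with h0
      · rw [h0, Omega.apply_zero k, hk N j hN]
      · rfl
    simp only [thresholdSum, this]
  refine le_of_tendsto_of_tendsto (hlim k) (hlim k') ?_
  filter_upwards [eventually_isFinThreshold_fill hL, eventually_gt_atTop M] with N hN hMN
  have hext : ∀ k : Omega n B, thresholdSum n (fillThreshold N L) (extDrift n B μ p f k)
      = thresholdSum n (fillThreshold N L) (drift n B μ p f k) := fun k =>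
    thresholdSum_congr_right hn fun i j _ _ hi hin => by
      have := hN.one_le hi hin
      rw [extDrift, if_neg (by lia)]
  rw [hext, hext]
  exact thresholdSum_drift_le hcox hconv h2 h3 hdec hle hN
    (by rw [hfill k hk N hMN, hfill k' hk' N hMN, heq])

/-! ### Perturbation to an ordered pair on which a given threshold is tight -/

/-- All the mass at length `M` and in the last phase, up to the restriction `ℓ ≤ M`. -/
noncomputable def topState (n : ℕ) (ℓ i : ℕ) : ℝ := if 1 ≤ ℓ ∧ 1 ≤ i ∧ i ≤ n then 1 else 0

/-- Scale by `a`, remove the lengths beyond `M`, and put mass `b` at length `M` in phase `n`. -/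
noncomputable def capState (n M : ℕ) (a b : ℝ) (x : ℕ → ℕ → ℝ) (ℓ i : ℕ) : ℝ :=
  if ℓ ≤ M then a * x ℓ i + b * topState n ℓ i else 0

lemma capState_mem {n M : ℕ} {B : ℕ∞} (hM : (M : ℕ∞) ≤ B) {a b : ℝ} (ha : 0 ≤ a) (hb : 0 ≤ b)
    (hab : a + b ≤ 1) (h : Omega n B) : capState n M a b h.1 ∈ Omega n B := by
  have hout : ∀ ℓ, M < ℓ → ∀ i, capState n M a b h.1 ℓ i = 0 := fun ℓ hℓ i => by
    rw [capState, if_neg (by lia)]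
  refine ⟨fun ℓ i hi => ?_, fun ℓ i hℓ hi hin => ?_, ?_⟩
  · by_cases hlM : ℓ ≤ M
    · have h0 : h.1 ℓ i = 0 := h.2.1 ℓ i hi
      have h1 : topState n ℓ i = 0 := by
        have : ¬ B < (ℓ : ℕ∞) := not_lt.2 (le_trans (by exact_mod_cast hlM) hM)
        rw [topState, if_neg]
        rintro ⟨_, _, _⟩
        rcases hi with hi | hi | hi | hi
        · lia
        · lia
        · lia
        · exact this hi
      simp [capState, h0, h1]
    · exact hout ℓ (by lia) i
  · by_cases hlM : ℓ ≤ M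
    · obtain ⟨h0, h1, h2, h3, h4⟩ := h.2.2.1 ℓ i hℓ hi hin
      have t1 : topState n ℓ i = 1 := if_pos ⟨hℓ, hi, hin⟩
      have t2 : topState n (ℓ + 1) i = 1 := if_pos ⟨by lia, hi, hin⟩
      have t3 : topState n (ℓ + 1) (i + 1) = topState n ℓ (i + 1) := by
        simp [topState, hℓ]
      have t4 : 0 ≤ topState n ℓ (i + 1) ∧ topState n ℓ (i + 1) ≤ 1 := by
        unfold topState; split_ifs <;> norm_num
      have n1 := Omega.nonneg h ℓ (i + 1)
      have m1 := mul_nonneg ha h0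
      have m2 := mul_le_mul_of_nonneg_left h1 ha
      have m3 := mul_le_mul_of_nonneg_left h2 ha
      have m4 := mul_le_mul_of_nonneg_left h3 ha
      have m5 := mul_le_mul_of_nonneg_left h4 ha
      have m6 := mul_nonneg hb (sub_nonneg.2 t4.2)
      simp only [capState, if_pos hlM, t1, t2, t3]
      split_ifs
      · refine ⟨?_, ?_, ?_, ?_, ?_⟩ <;> nlinarith
      · refine ⟨?_, ?_, ?_, ?_, ?_⟩ <;> nlinarith
    · rw [hout ℓ (by lia), hout ℓ (by lia), hout (ℓ + 1) (by lia), hout (ℓ + 1) (by lia)]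
      norm_num
  · refine summable_of_ne_finset_zero (s := Finset.range (M + 1)) fun ℓ hℓ => hout ℓ ?_ 1
    rw [Finset.mem_range] at hℓ
    lia

/-- Replace the entries beyond `M` by infinity. -/
def capThreshold (M : ℕ) (L : ℕ → ℕ) (i : ℕ) : ℕ := if L i ≤ M then L i else 0

lemma capThreshold_le (M : ℕ) (L : ℕ → ℕ) (i : ℕ) : capThreshold M L i ≤ M := by
  unfold capThreshold; split_ifs <;> lia

lemma capThreshold_of_le {M : ℕ} {L : ℕ → ℕ} (hL : ∀ i, L i ≤ M) : capThreshold M L = L :=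
  funext fun i => if_pos (hL i)

lemma IsExtThreshold.cap {n : ℕ} {L : ℕ → ℕ} (hL : IsExtThreshold n L) (M : ℕ) :
    IsExtThreshold n (capThreshold M L) := by
  intro i hi hin h0
  have h1 := hL i hi hin
  unfold capThreshold at *
  split_ifs at * <;> lia

lemma IsExtThreshold.eq_zero {n : ℕ} {L : ℕ → ℕ} (hL : IsExtThreshold n L) (h0 : L n = 0)
    (i : ℕ) (hi : 1 ≤ i) (hin : i ≤ n) : L i = 0 := by
  by_contra hc
  have : ∀ j, i ≤ j → j ≤ n → L j ≠ 0 := by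
    intro j hij
    induction j, hij using Nat.le_induction with
    | base => exact fun _ => hc
    | succ m hm ih => exact fun hmn => (hL m (by lia) (by lia) (ih (by lia))).1
  exact this n hin le_rfl h0

lemma thresholdSum_topState {n : ℕ} (hn : 1 ≤ n) (L : ℕ → ℕ) :
    thresholdSum n L (topState n) = if L n = 0 then 0 else 1 := by
  rw [thresholdSum_eq_sum hn L (fun ℓ => by simp [topState])]
  rw [Finset.sum_eq_single_of_mem n (Finset.mem_Icc.2 ⟨hn, le_rfl⟩)]
  · by_cases h0 : L n = 0
    · simp [topState, h0]
    · simp [topState, h0, hn, Nat.one_le_iff_ne_zero.2 h0]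
  · intro i hi hne
    rw [Finset.mem_Icc] at hi
    simp [topState, hi.1, hi.2, show i + 1 ≤ n by lia]

lemma thresholdSum_capState {n : ℕ} (M : ℕ) (a b : ℝ) (L : ℕ → ℕ)
    {x : ℕ → ℕ → ℝ} (hx : ∀ i, x 0 i = 0) :
    thresholdSum n L (capState n M a b x)
      = a * thresholdSum n (capThreshold M L) x
        + b * thresholdSum n (capThreshold M L) (topState n) := by
  rw [← thresholdSum_const_mul, ← thresholdSum_const_mul, ← thresholdSum_add]
  have : ∀ i j, capState n M a b x (L i) j
      = a * x (capThreshold M L i) j + b * topState n (capThreshold M L i) j := by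
    intro i j
    unfold capState capThreshold
    split_ifs with h
    · rfl
    · simp [hx, topState]
  simp only [thresholdSum, this]

/-- `topState` has threshold sum `1` unless all entries are infinite, so adding a multiple of it to
the upper state shifts every nontrivial inequality by the same amount. -/
theorem exists_leC_tight {n M : ℕ} {B : ℕ∞} (hn : 1 ≤ n) (hM : (M : ℕ∞) ≤ B)
    (h h' : Omega n B) {V : ℝ} (hV : 0 < V) (hV1 : V ≤ 1)
    (hmax : ∀ L, IsExtThreshold n L → (∀ i, L i ≤ M) →
      thresholdSum n L h.1 - thresholdSum n L h'.1 ≤ V)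
    {L₀ : ℕ → ℕ} (hL₀ : IsExtThreshold n L₀) (hL₀M : ∀ i, L₀ i ≤ M)
    (heq : thresholdSum n L₀ h.1 - thresholdSum n L₀ h'.1 = V)
    (htail : ∀ ℓ i, M < ℓ → h.1 ℓ i ≤ V) (htail' : ∀ ℓ i, M < ℓ → h'.1 ℓ i ≤ V) :
    ∃ k k' : Omega n B, LeC k k' ∧ thresholdSum n L₀ k.1 = thresholdSum n L₀ k'.1 ∧
      (∀ ℓ i, M < ℓ → k.1 ℓ i = 0) ∧ (∀ ℓ i, M < ℓ → k'.1 ℓ i = 0) ∧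
      (∀ ℓ i, |k.1 ℓ i - h.1 ℓ i| ≤ V) ∧ (∀ ℓ i, |k'.1 ℓ i - h'.1 ℓ i| ≤ V) := by
  have ha : 0 ≤ 1 - V := sub_nonneg.2 hV1
  have hb : 0 ≤ (1 - V) * V := mul_nonneg ha hV.le
  -- Scaling by `1 - V` turns the maximal gap into `(1 - V) * V`, which the added mass cancels; the
  -- scaling leaves room for it, as `(1 - V) * (1 + V) ≤ 1`.
  refine ⟨⟨_, capState_mem hM ha le_rfl (by linarith) h⟩,
    ⟨_, capState_mem hM ha hb (by nlinarith) h'⟩, ?_, ?_, ?_, ?_, ?_, ?_⟩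
  · rw [leC_iff hn]
    intro L hL
    rw [thresholdSum_capState M _ _ L (Omega.apply_zero h),
      thresholdSum_capState M _ _ L (Omega.apply_zero h'), thresholdSum_topState hn]
    have hc := hL.cap M
    split_ifs with h0
    · rw [thresholdSum_const hn 0 _ (hc.eq_zero h0), thresholdSum_const hn 0 _ (hc.eq_zero h0),
        Omega.apply_zero, Omega.apply_zero]
      simp
    · nlinarith [mul_le_mul_of_nonneg_left (hmax _ hc (capThreshold_le M L)) ha]
  · rw [thresholdSum_capState M _ _ L₀ (Omega.apply_zero h),
      thresholdSum_capState M _ _ L₀ (Omega.apply_zero h'), thresholdSum_topState hn,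
      capThreshold_of_le hL₀M]
    split_ifs with h0
    · rw [thresholdSum_const hn 0 _ (hL₀.eq_zero h0), thresholdSum_const hn 0 _ (hL₀.eq_zero h0),
        Omega.apply_zero, Omega.apply_zero] at heq
      linarith
    · rw [← heq]; ring
  · intro ℓ i hℓ
    exact if_neg (by lia)
  · intro ℓ i hℓ
    exact if_neg (by lia)
  · intro ℓ i
    have h0 := Omega.nonneg h ℓ i
    have h1 := Omega.le_one h ℓ i
    by_cases hℓ : ℓ ≤ M
    · simp only [capState, if_pos hℓ]
      rw [abs_le]
      constructor <;> nlinarith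
    · simp only [capState, if_neg hℓ]
      rw [zero_sub, abs_neg, abs_of_nonneg h0]
      exact htail ℓ i (by lia)
  · intro ℓ i
    have h0 := Omega.nonneg h' ℓ i
    have h1 := Omega.le_one h' ℓ i
    by_cases hℓ : ℓ ≤ M
    · simp only [capState, if_pos hℓ]
      have ht : (topState n ℓ i = 0 ∧ h'.1 ℓ i = 0) ∨ topState n ℓ i = 1 := by
        rcases Omega.cases_index h' ℓ i with hz | hi
        · by_cases hc : 1 ≤ ℓ ∧ 1 ≤ i ∧ i ≤ n
          · exact Or.inr (if_pos hc)
          · exact Or.inl ⟨if_neg hc, hz⟩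
        · exact Or.inr (if_pos hi)
      rcases ht with ⟨ht, hz⟩ | ht
      · rw [ht, hz]; simpa using hV.le
      · rw [ht, abs_le]
        constructor <;> nlinarith
    · simp only [capState, if_neg hℓ]
      rw [zero_sub, abs_neg, abs_of_nonneg h0]
      exact htail' ℓ i (by lia)

/-! ### A barrier argument -/

lemma le_linear_barrier {ι : Type*} [Finite ι] {φ φ' : ι → ℝ → ℝ} {a b ε A : ℝ} (hε : 0 < ε)
    (hder : ∀ c, ∀ t ∈ Set.Icc a b, HasDerivWithinAt (φ c) (φ' c t) (Set.Ici a) t)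
    (h0 : ∀ c, φ c a ≤ 0)
    (hstep : ∀ t ∈ Set.Ico a b, ∀ c, (∀ c', φ c' t ≤ ε * (1 + A * (t - a))) →
      φ c t = ε * (1 + A * (t - a)) → φ' c t < ε * A) :
    ∀ t ∈ Set.Icc a b, ∀ c, φ c t ≤ ε * (1 + A * (t - a)) := by
  set g : ι → ℝ → ℝ := fun c t => φ c t - ε * (1 + A * (t - a)) with hg
  have hgder : ∀ c, ∀ t ∈ Set.Icc a b,
      HasDerivWithinAt (g c) (φ' c t - ε * A) (Set.Ici a) t := by
    intro c t ht
    have h1 : HasDerivWithinAt (fun t : ℝ => ε * (1 + A * (t - a))) (ε * (A * 1))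
        (Set.Ici a) t :=
      ((((hasDerivWithinAt_id t _).sub_const a).const_mul A).const_add 1).const_mul ε
    rw [mul_one] at h1
    exact (hder c t ht).sub h1
  have hcont : ∀ c, ContinuousOn (g c) (Set.Icc a b) := fun c t ht =>
    (hgder c t ht).continuousWithinAt.mono Set.Icc_subset_Ici_self
  have hsub : Set.Icc a b ⊆ {t | ∀ c, g c t ≤ 0} := by
    refine IsClosed.Icc_subset_of_forall_mem_nhdsWithin ?_ ?_ ?_
    · have : {t | ∀ c, g c t ≤ 0} ∩ Set.Icc a b
          = Set.Icc a b ∩ ⋂ c, (Set.Icc a b ∩ g c ⁻¹' Set.Iic 0) := by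
        ext t
        simp only [Set.mem_inter_iff, Set.mem_ofPred_eq, Set.mem_iInter, Set.mem_preimage,
          Set.mem_Iic]
        grind
      rw [this]
      exact isClosed_Icc.inter (isClosed_iInter fun c =>
        (hcont c).preimage_isClosed_of_isClosed isClosed_Icc isClosed_Iic)
    · intro c
      have := h0 c
      simp only [hg, sub_self, mul_zero, add_zero, mul_one]
      linarith
    · rintro t ⟨ht, htI⟩
      have hall : ∀ c, ∀ᶠ s in 𝓝[>] t, g c s ≤ 0 := by
        intro c
        have htI' : t ∈ Set.Icc a b := ⟨htI.1, htI.2.le⟩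
        have hd : HasDerivWithinAt (g c) (φ' c t - ε * A) (Set.Ioi t) t :=
          (hgder c t htI').mono fun s hs => htI.1.trans (le_of_lt hs)
        rcases (ht c).lt_or_eq with hlt | heq
        · filter_upwards [hd.continuousWithinAt.eventually_lt_const hlt] with s hs
          exact hs.le
        · have hneg : φ' c t - ε * A < 0 := by
            have := hstep t htI c (fun c' => by have := ht c'; simp only [hg] at this; linarith)
              (by simp only [hg] at heq; linarith)
            linarith
          -- At a contact point `g c t = 0` with negative right derivative, so the barrier is not
          -- crossed just after `t`.
          filter_upwards [hd.limsup_slope_le' (by simp) hneg, self_mem_nhdsWithin] with s hs hts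
          rw [slope_def_field, heq, sub_zero] at hs
          by_contra hc
          push Not at hc
          exact absurd hs (not_lt.2 (div_nonneg hc.le (sub_nonneg.2 (le_of_lt hts))))
      filter_upwards [eventually_all.2 hall] with s hs
      exact hs
  intro t ht c
  have := hsub ht c
  simp only [hg] at this
  linarith

/-! ### Uniform tails -/

lemma IsSolution.exists_uniform_tail {n : ℕ} {B : ℕ∞} {μ p : ℕ → ℝ}
    {f : ℕ → ℕ → Omega n B → ℝ} {u : ℝ → Omega n B} (hu : IsSolution n B μ p f u)
    {a b : ℝ} (ha : 0 ≤ a) {ε : ℝ} (hε : 0 < ε) :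
    ∃ M : ℕ, ∀ t ∈ Set.Icc a b, ∀ ℓ i, M < ℓ → (u t).1 ℓ i ≤ ε := by
  refine isCompact_Icc.induction_on (p := fun s => ∃ M : ℕ, ∀ t ∈ s, ∀ ℓ i, M < ℓ →
    (u t).1 ℓ i ≤ ε) ⟨0, by simp⟩ ?_ ?_ ?_
  · rintro s s' hs ⟨M, hM⟩
    exact ⟨M, fun t ht => hM t (hs ht)⟩
  · rintro s s' ⟨M, hM⟩ ⟨M', hM'⟩
    refine ⟨max M M', fun t ht ℓ i hℓ => ?_⟩
    rcases ht with ht | ht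
    · exact hM t ht ℓ i (lt_of_le_of_lt (le_max_left _ _) hℓ)
    · exact hM' t ht ℓ i (lt_of_le_of_lt (le_max_right _ _) hℓ)
  · intro t ht
    have ht0 : 0 ≤ t := ha.trans ht.1
    obtain ⟨N, hN, hN1⟩ := ((Omega.tendsto_length (u t) 1).eventually_lt_const
      (show (0 : ℝ) < ε / 2 by linarith)).and (eventually_ge_atTop 1) |>.exists
    refine ⟨_, nhdsWithin_mono t (fun s hs => ha.trans hs.1)
      (hu.eventually_abs_sub_le ht0 (half_pos hε)), N, fun s hs ℓ i hℓ => ?_⟩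
    have h1 := Omega.le_of_le (u s) hN1 hℓ.le i
    have h2 := abs_le.1 (hs N 1)
    linarith

lemma abs_thresholdSum_sub_cap_le {n M : ℕ} {B : ℕ∞} (hn : 1 ≤ n) (h : Omega n B) {ε : ℝ}
    (hε : 0 ≤ ε) (htail : ∀ ℓ i, M < ℓ → h.1 ℓ i ≤ ε) (L : ℕ → ℕ) :
    |thresholdSum n L h.1 - thresholdSum n (capThreshold M L) h.1| ≤ 2 * n * ε := by
  -- With `a = 1`, `b = 0`: capping the threshold amounts to truncating the state.
  have h1 := thresholdSum_capState (n := n) M 1 0 L (Omega.apply_zero h)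
  rw [one_mul, zero_mul, add_zero] at h1
  rw [← h1, ← thresholdSum_sub]
  refine abs_thresholdSum_le hn fun i j _ _ _ _ => ?_
  unfold capState
  split_ifs with hL
  · simpa using hε
  · rw [sub_zero, abs_of_nonneg (Omega.nonneg h _ _)]
    exact htail _ _ (by lia)

/-! ### Propagation of the order -/

lemma IsSolution.hasDerivWithinAt_thresholdSum {n : ℕ} {B : ℕ∞} {μ p : ℕ → ℝ}
    {f : ℕ → ℕ → Omega n B → ℝ} (hn : 1 ≤ n) {u : ℝ → Omega n B}
    (hu : IsSolution n B μ p f u) (L : ℕ → ℕ) {t : ℝ} (ht : 0 ≤ t) :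
    HasDerivWithinAt (fun s => thresholdSum n L (u s).1)
      (thresholdSum n L (extDrift n B μ p f (u t))) (Set.Ici 0) t := by
  have key : ∀ ℓ i, 1 ≤ i → i ≤ n → HasDerivWithinAt (fun s => (u s).1 ℓ i)
      (extDrift n B μ p f (u t) ℓ i) (Set.Ici 0) t := by
    intro ℓ i hi hin
    unfold extDrift
    split_ifs with h0
    · subst h0
      simp only [Omega.apply_zero]
      exact hasDerivWithinAt_const t _ _
    · exact hu t ht ℓ i (by lia) hi hin
  unfold thresholdSum
  refine (key _ 1 le_rfl hn).add (HasDerivWithinAt.fun_sum fun i hi => ?_)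
  rw [Finset.mem_Icc] at hi
  exact (key _ i (by lia) hi.2).sub (key _ i (by lia) hi.2)

lemma abs_thresholdSum_extDrift_sub_le {n : ℕ} {B : ℕ∞} {μ p : ℕ → ℝ}
    {f : ℕ → ℕ → Omega n B → ℝ} (hn : 1 ≤ n) {k h : Omega n B} {D : ℝ} (hD : 0 ≤ D)
    (hkh : ∀ ℓ i : ℕ, 1 ≤ ℓ → 1 ≤ i → i ≤ n →
      |drift n B μ p f k ℓ i - drift n B μ p f h ℓ i| ≤ D) (L : ℕ → ℕ) :
    |thresholdSum n L (extDrift n B μ p f k) - thresholdSum n L (extDrift n B μ p f h)|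
      ≤ 2 * n * D := by
  rw [← thresholdSum_sub]
  refine abs_thresholdSum_le hn fun i j hj hjn _ _ => ?_
  unfold extDrift
  split_ifs with h0
  · simpa using hD
  · exact hkh _ j (by lia) hj hjn

theorem exists_leC_Icc {n : ℕ} {B : ℕ∞} {μ p : ℕ → ℝ} {f : ℕ → ℕ → Omega n B → ℝ}
    (hcox : IsCoxian n μ p) (hconv : ArrivalConvention n B f)
    (hlip : DriftLocallyLipschitz n B μ p f) (h1 : UniqueSolutionsAndFixedPoint n B μ p f)
    (h2 : MonotoneInOthers n B f) (h3 : MonotoneThreshold n B f) (hdec : RatesDecreasing n μ p)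
    {h h' : ℝ → Omega n B} (hsol : IsSolution n B μ p f h) (hsol' : IsSolution n B μ p f h')
    {a : ℝ} (ha : 0 ≤ a) (hle : LeC (h a) (h' a)) :
    ∃ δ > 0, ∀ t ∈ Set.Icc a (a + δ), LeC (h t) (h' t) := by
  have hn := hcox.one_le
  obtain ⟨r, K, hr, hK, hLip⟩ := hlip (h a)
  obtain ⟨r', K', hr', hK', hLip'⟩ := hlip (h' a)
  obtain ⟨δ₁, hδ₁, hball⟩ := Metric.mem_nhdsWithin_iff.1
    ((hsol.eventually_abs_sub_le ha (half_pos hr)).and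
      (hsol'.eventually_abs_sub_le ha (half_pos hr')))
  set C : ℝ := 2 * n * K + 2 * n * K' with hC
  have hC0 : 0 ≤ C := by positivity
  -- The violation is at most `2 * ε` while `A * δ ≤ 1`, so it grows at rate at most `2 * C * ε < ε
  -- * A`.
  set A : ℝ := 2 * C + 1 with hA
  have hA0 : 0 < A := by positivity
  set δ : ℝ := min (δ₁ / 2) (1 / A) with hδdef
  have hδ : 0 < δ := lt_min (by linarith) (by positivity)
  have hδA : A * δ ≤ 1 := by
    have : δ ≤ 1 / A := min_le_right _ _
    rw [le_div_iff₀ hA0] at this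
    linarith
  have hnear : ∀ t ∈ Set.Icc a (a + δ), (∀ ℓ i : ℕ, |(h t).1 ℓ i - (h a).1 ℓ i| ≤ r / 2) ∧
      ∀ ℓ i : ℕ, |(h' t).1 ℓ i - (h' a).1 ℓ i| ≤ r' / 2 := by
    intro t ht
    refine hball ⟨?_, ha.trans ht.1⟩
    have := min_le_left (δ₁ / 2) (1 / A)
    rw [Metric.mem_ball, Real.dist_eq, abs_of_nonneg (sub_nonneg.2 ht.1)]
    linarith [ht.2]
  -- The barrier accounts for `2 * ε`, and capping the threshold costs `2 * n * ε` for each of the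
  -- two states.
  have main : ∀ ε : ℝ, 0 < ε → 2 * ε ≤ 1 → 2 * ε ≤ r / 2 → 2 * ε ≤ r' / 2 →
      ∀ L, IsExtThreshold n L → ∀ t ∈ Set.Icc a (a + δ),
      thresholdSum n L (h t).1 - thresholdSum n L (h' t).1 ≤ (2 + 4 * n) * ε := by
    intro ε hε hε1 hεr hεr' L hL t ht
    obtain ⟨M, hMB, htail, htail'⟩ : ∃ M : ℕ, (M : ℕ∞) ≤ B ∧
        (∀ t ∈ Set.Icc a (a + δ), ∀ ℓ i, M < ℓ → (h t).1 ℓ i ≤ ε) ∧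
        ∀ t ∈ Set.Icc a (a + δ), ∀ ℓ i, M < ℓ → (h' t).1 ℓ i ≤ ε := by
      induction B using ENat.recTopCoe with
      | top =>
        obtain ⟨M, hM⟩ := hsol.exists_uniform_tail (b := a + δ) ha hε
        obtain ⟨M', hM'⟩ := hsol'.exists_uniform_tail (b := a + δ) ha hε
        exact ⟨max M M', le_top,
          fun t ht ℓ i hℓ => hM t ht ℓ i (lt_of_le_of_lt (le_max_left _ _) hℓ),
          fun t ht ℓ i hℓ => hM' t ht ℓ i (lt_of_le_of_lt (le_max_right _ _) hℓ)⟩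
      | coe b =>
        have hz : ∀ (u : Omega n b) (ℓ i : ℕ), b < ℓ → u.1 ℓ i ≤ ε := fun u ℓ i hℓ => by
          rw [u.2.1 ℓ i (Or.inr (Or.inr (Or.inr (by exact_mod_cast hℓ))))]; exact hε.le
        exact ⟨b, le_rfl, fun t _ => hz (h t), fun t _ => hz (h' t)⟩
    -- A finite index type for the thresholds with entries at most `M`, as the barrier argument
    -- requires.
    let ext : (Fin (n + 1) → Fin (M + 1)) → ℕ → ℕ := fun c i =>
      if hi : i < n + 1 then (c ⟨i, hi⟩ : ℕ) else 0
    have ext_le : ∀ c i, ext c i ≤ M := by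
      intro c i
      simp only [ext]
      split_ifs <;> lia
    have exists_ext : ∀ L : ℕ → ℕ, (∀ i, L i ≤ M) → ∃ c, ∀ i ≤ n, ext c i = L i := by
      intro L hLM
      refine ⟨fun i => ⟨L i, by have := hLM i; lia⟩, fun i hi => ?_⟩
      simp only [ext, dif_pos (show i < n + 1 by lia)]
    have isExt_congr : ∀ {L L' : ℕ → ℕ}, (∀ i ≤ n, L i = L' i) → IsExtThreshold n L' →
        IsExtThreshold n L := by
      intro L L' hLL hL' i hi hin h0
      rw [hLL i (by lia)] at h0 ⊢
      rw [hLL (i + 1) (by lia)]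
      exact hL' i hi hin h0
    have hbar := le_linear_barrier (ι := {c // IsExtThreshold n (ext c)})
      (φ := fun c t => thresholdSum n (ext c.1) (h t).1 - thresholdSum n (ext c.1) (h' t).1)
      (φ' := fun c t => thresholdSum n (ext c.1) (extDrift n B μ p f (h t))
        - thresholdSum n (ext c.1) (extDrift n B μ p f (h' t)))
      (a := a) (b := a + δ) (ε := ε) (A := A) hε
      (fun c t ht => ((hsol.hasDerivWithinAt_thresholdSum hn _ (ha.trans ht.1)).sub
        (hsol'.hasDerivWithinAt_thresholdSum hn _ (ha.trans ht.1))).mono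
          (Set.Ici_subset_Ici.2 ha))
      (fun c => sub_nonpos.2 ((leC_iff hn).1 hle _ c.2))
      (by
        intro s hs c hmax heq
        have hsI : s ∈ Set.Icc a (a + δ) := ⟨hs.1, hs.2.le⟩
        set V : ℝ := ε * (1 + A * (s - a)) with hV
        have hAs : 0 ≤ A * (s - a) ∧ A * (s - a) ≤ 1 := by
          have h1 : s - a ≤ δ := by linarith [hs.2]
          exact ⟨mul_nonneg hA0.le (sub_nonneg.2 hs.1),
            (mul_le_mul_of_nonneg_left h1 hA0.le).trans hδA⟩
        have hεV : ε ≤ V := by nlinarith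
        have hV2 : V ≤ 2 * ε := by nlinarith
        obtain ⟨k, k', hkk, htight, hk0, hk0', hkh, hkh'⟩ := exists_leC_tight hn hMB (h s) (h' s)
          (V := V) (by linarith) (by linarith)
          (fun L hL hLM => by
            obtain ⟨c', hc'⟩ := exists_ext L hLM
            have := hmax ⟨c', isExt_congr hc' hL⟩
            simp only at this
            rwa [thresholdSum_congr hn _ fun i _ hi => hc' i hi,
              thresholdSum_congr hn _ fun i _ hi => hc' i hi] at this)
          c.2 (ext_le c.1) heq
          (fun ℓ i hℓ => (htail s hsI ℓ i hℓ).trans hεV)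
          (fun ℓ i hℓ => (htail' s hsI ℓ i hℓ).trans hεV)
        have hmono := thresholdSum_extDrift_le hcox hconv hlip h1 h2 h3 hdec hkk hk0 hk0' c.2
          htight
        have hV0 : 0 ≤ V := by linarith
        -- `k` is within `V ≤ 2 * ε ≤ r / 2` of `h s`, which is within `r / 2` of `h a`: both lie in
        -- the Lipschitz ball.
        have hd := abs_thresholdSum_extDrift_sub_le hn (mul_nonneg hK hV0)
          (hLip k (h s)
            (fun ℓ i => by
              have := abs_sub_le (k.1 ℓ i) ((h s).1 ℓ i) ((h a).1 ℓ i)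
              linarith [hkh ℓ i, (hnear s hsI).1 ℓ i])
            (fun ℓ i => by linarith [(hnear s hsI).1 ℓ i]) V hkh) (ext c.1)
        have hd' := abs_thresholdSum_extDrift_sub_le hn (mul_nonneg hK' hV0)
          (hLip' k' (h' s)
            (fun ℓ i => by
              have := abs_sub_le (k'.1 ℓ i) ((h' s).1 ℓ i) ((h' a).1 ℓ i)
              linarith [hkh' ℓ i, (hnear s hsI).2 ℓ i])
            (fun ℓ i => by linarith [(hnear s hsI).2 ℓ i]) V hkh') (ext c.1)
        rw [abs_le] at hd hd'
        have hCV : 2 * n * (K * V) + 2 * n * (K' * V) = C * V := by rw [hC]; ring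
        have : C * V ≤ C * (2 * ε) := mul_le_mul_of_nonneg_left hV2 hC0
        have hfin : C * (2 * ε) < ε * A := by rw [hA]; nlinarith
        linarith [hd.1, hd'.2])
    obtain ⟨c, hc⟩ := exists_ext (capThreshold M L) (capThreshold_le M L)
    have hbt := hbar t ht ⟨c, isExt_congr hc (hL.cap M)⟩
    simp only at hbt
    rw [thresholdSum_congr hn _ fun i _ hi => hc i hi,
      thresholdSum_congr hn _ fun i _ hi => hc i hi] at hbt
    have e1 := (abs_le.1 (abs_thresholdSum_sub_cap_le hn (h t) hε.le (htail t ht) L)).2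
    have e2 := (abs_le.1 (abs_thresholdSum_sub_cap_le hn (h' t) hε.le (htail' t ht) L)).1
    have h5 : A * (t - a) ≤ 1 :=
      (mul_le_mul_of_nonneg_left (by linarith [ht.2]) hA0.le).trans hδA
    nlinarith
  refine ⟨δ, hδ, fun t ht => (leC_iff hn).2 fun L hL => ?_⟩
  refine le_of_forall_pos_le_add fun η hη => ?_
  set ε : ℝ := min (min (1 / 2) (η / (2 + 4 * n))) (min (r / 4) (r' / 4)) with hεdef
  have hε : 0 < ε := by positivity
  have b1 : ε ≤ 1 / 2 := (min_le_left _ _).trans (min_le_left _ _)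
  have b2 : ε ≤ η / (2 + 4 * n) := (min_le_left _ _).trans (min_le_right _ _)
  have b3 : ε ≤ r / 4 := (min_le_right _ _).trans (min_le_left _ _)
  have b4 : ε ≤ r' / 4 := (min_le_right _ _).trans (min_le_right _ _)
  rw [le_div_iff₀ (by positivity)] at b2
  linarith [main ε hε (by linarith) (by linarith) (by linarith) L hL t ht]

end CoxMF

theorem proposition6 (n : ℕ) (B : ℕ∞) (μ p : ℕ → ℝ)
    (f : ℕ → ℕ → CoxMF.Omega n B → ℝ)
    (hcox : CoxMF.IsCoxian n μ p)
    (hconv : CoxMF.ArrivalConvention n B f)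
    (hlip : CoxMF.DriftLocallyLipschitz n B μ p f)
    (h1 : CoxMF.UniqueSolutionsAndFixedPoint n B μ p f)
    (h2 : CoxMF.MonotoneInOthers n B f)
    (h3 : CoxMF.MonotoneThreshold n B f)
    (hdec : CoxMF.RatesDecreasing n μ p)
    (h h' : ℝ → CoxMF.Omega n B)
    (hsol : CoxMF.IsSolution n B μ p f h)
    (hsol' : CoxMF.IsSolution n B μ p f h')
    (hle : CoxMF.LeC (h 0) (h' 0)) :
    ∀ t : ℝ, 0 < t → CoxMF.LeC (h t) (h' t) := by
  intro T hT
  have hn := hcox.one_le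
  suffices hsub : Set.Icc 0 T ⊆ {t | CoxMF.LeC (h t) (h' t)} from hsub ⟨hT.le, le_rfl⟩
  -- The ordered times form a closed set, as each `g_L` is continuous along solutions, and the local
  -- result extends the order to the right of each such time.
  refine IsClosed.Icc_subset_of_forall_mem_nhdsWithin ?_ hle ?_
  · have hset : {t | CoxMF.LeC (h t) (h' t)} ∩ Set.Icc 0 T
        = Set.Icc 0 T ∩ ⋂ (L : ℕ → ℕ) (_ : CoxMF.IsExtThreshold n L), (Set.Icc 0 T ∩
          (fun t => CoxMF.thresholdSum n L (h t).1 - CoxMF.thresholdSum n L (h' t).1)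
            ⁻¹' Set.Iic 0) := by
      ext t
      simp only [Set.mem_inter_iff, Set.mem_ofPred_eq, Set.mem_iInter, Set.mem_preimage,
        Set.mem_Iic, CoxMF.leC_iff hn, sub_nonpos]
      grind
    rw [hset]
    refine isClosed_Icc.inter (isClosed_iInter fun L => isClosed_iInter fun _ =>
      ContinuousOn.preimage_isClosed_of_isClosed (fun t ht => ?_) isClosed_Icc isClosed_Iic)
    exact ((hsol.hasDerivWithinAt_thresholdSum hn L ht.1).sub
      (hsol'.hasDerivWithinAt_thresholdSum hn L ht.1)).continuousWithinAt.mono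
        Set.Icc_subset_Ici_self
  · rintro t ⟨htC, htI⟩
    obtain ⟨δ, hδ, hstep⟩ :=
      CoxMF.exists_leC_Icc hcox hconv hlip h1 h2 h3 hdec hsol hsol' htI.1 htC
    exact Filter.mem_of_superset (Icc_mem_nhdsGT (by linarith)) hstep
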